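/- Let $R$ be a left Noetherian (associative, unital, not necessarily commutative) ring. For a left $R$-module $M$ let $$0\to M\to E^0(M)\to E^1(M)\to E^2(M)\to\cdots$$ be a minimal injective coresolution, i.e. an exact sequence with all $E^n(M)$ injective in which the image of $M$ is essential in $E^0(M)$ and the image of $E^{n}(M)$ is essential in $E^{n+1}(M)$ for every $n\ge 0$; the module $E^n(M)$ is unique up to isomorphism. Let $\operatorname{fd}_R X\in\mathbb{N}\cup\{\infty\}$ denote the flat dimension of a left $R$-module $X$, i.e. the least $k\ge 0$ such that there is an exact sequence $0\to F_k\to\cdots\to F_0\to X\to 0$ with all $F_i$ flat (and $\infty$ if there is none; in particular $\operatorname{fd}_R 0=0$). (1) Let $n,k\ge 0$, let $I$ be a (nonempty) directed index set, let $\{M_i\}_{i\in I}$ be a directed system of left $R$-modules, and let $M=\varinjlim_{i\in I}M_i$. If $\operatorname{fd}_R E^n(M_i)\le k$ for all $i\in I$, then $\operatorname{fd}_R E^n(M)\le k$. (2) For every $n\ge 0$, $$\operatorname{fd}_R E^n({}_RR)=\sup\{\operatorname{fd}_R E^n(F)\mid F \text{ a flat left } R\text{-module}\}.$$ -/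

import Mathlib

open scoped TensorProduct

universe u v w x y

/-- The subgroup of `N ⊗[ℤ] M` generated by the elements `n·r ⊗ m - n ⊗ r·m`, for a right `R`-module
`N` (a module over `Rᵐᵒᵖ`) and a left `R`-module `M`. -/
def balancedRelations (R : Type u) [Ring R] (N : Type w) [AddCommGroup N] [Module Rᵐᵒᵖ N]
    (M : Type v) [AddCommGroup M] [Module R M] : AddSubgroup (N ⊗[ℤ] M) :=
  AddSubgroup.closure {t | ∃ (n : N) (r : R) (m : M),
    t = (MulOpposite.op r • n) ⊗ₜ[ℤ] m - n ⊗ₜ[ℤ] (r • m)}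

/-- The abelian group `N ⊗_R M` for a right module `N` and a left module `M` over a (possibly
noncommutative) ring `R`. -/
abbrev BalancedTensor (R : Type u) [Ring R] (N : Type w) [AddCommGroup N] [Module Rᵐᵒᵖ N]
    (M : Type v) [AddCommGroup M] [Module R M] : Type (max w v) :=
  (N ⊗[ℤ] M) ⧸ balancedRelations R N M

theorem balancedRelations_le_comap {R : Type u} [Ring R] {N : Type w} [AddCommGroup N]
    [Module Rᵐᵒᵖ N] {N' : Type x} [AddCommGroup N'] [Module Rᵐᵒᵖ N'] (f : N →ₗ[Rᵐᵒᵖ] N')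
    (M : Type v) [AddCommGroup M] [Module R M] :
    balancedRelations R N M ≤
      (balancedRelations R N' M).comap
        (f.toAddMonoidHom.toIntLinearMap.rTensor M).toAddMonoidHom := by
  refine (AddSubgroup.closure_le _).mpr ?_
  rintro _ ⟨n, r, m, rfl⟩
  refine AddSubgroup.subset_closure ⟨f n, r, m, ?_⟩
  simp

/-- The homomorphism `f ⊗ 1 : N ⊗_R M → N' ⊗_R M`. -/
def BalancedTensor.map {R : Type u} [Ring R] {N : Type w} [AddCommGroup N]
    [Module Rᵐᵒᵖ N] {N' : Type x} [AddCommGroup N'] [Module Rᵐᵒᵖ N'] (f : N →ₗ[Rᵐᵒᵖ] N')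
    (M : Type v) [AddCommGroup M] [Module R M] :
    BalancedTensor R N M →+ BalancedTensor R N' M :=
  QuotientAddGroup.map _ _ (f.toAddMonoidHom.toIntLinearMap.rTensor M).toAddMonoidHom
    (balancedRelations_le_comap f M)

/-- A left module `M` over a ring `R` is flat if `- ⊗_R M` preserves injectivity of homomorphisms
of right `R`-modules. (Right modules in the universe of `R` suffice, since right ideals do.) -/
def IsFlatModule (R : Type u) [Ring R] (M : Type v) [AddCommGroup M] [Module R M] : Prop :=
  ∀ ⦃N N' : Type u⦄ [AddCommGroup N] [AddCommGroup N'] [Module Rᵐᵒᵖ N] [Module Rᵐᵒᵖ N']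
    (f : N →ₗ[Rᵐᵒᵖ] N'), Function.Injective f → Function.Injective (BalancedTensor.map f M)

/-- A flat resolution `⋯ → F₁ → F₀ → M → 0` of a left `R`-module `M`. -/
structure FlatResolution (R : Type u) [Ring R] (M : Type v) [AddCommGroup M] [Module R M] where
  F : ℕ → Type (max u v)
  [addCommGroup : ∀ i, AddCommGroup (F i)]
  [module : ∀ i, Module R (F i)]
  ε : F 0 →ₗ[R] M
  d : ∀ i, F (i + 1) →ₗ[R] F i
  flat : ∀ i, IsFlatModule R (F i)
  surjective_ε : Function.Surjective ε
  exact_zero : Function.Exact (d 0) ε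
  exact_succ : ∀ i, Function.Exact (d (i + 1)) (d i)

attribute [instance] FlatResolution.addCommGroup FlatResolution.module

/-- The flat dimension of a left `R`-module `M`: the least length `k` of a flat resolution
`0 → F_k → ⋯ → F₀ → M → 0`, and `⊤` if there is none of finite length. -/
noncomputable def flatDimension (R : Type u) [Ring R] (M : Type v) [AddCommGroup M] [Module R M] :
    ℕ∞ :=
  sInf {e | ∃ (k : ℕ) (P : FlatResolution R M), (∀ i, k < i → Subsingleton (P.F i)) ∧ e = k}

/-- A submodule is essential if it meets every nonzero submodule nontrivially. -/
def IsEssentialSubmodule {R : Type u} [Ring R] {E : Type v} [AddCommGroup E] [Module R E]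
    (A : Submodule R E) : Prop :=
  ∀ N : Submodule R E, N ⊓ A = ⊥ → N = ⊥

/-- A minimal injective coresolution `0 → M → E⁰ → E¹ → ⋯` of a left `R`-module `M`: an exact
sequence with injective terms in which `M → E⁰` and each `Eⁿ / im → Eⁿ⁺¹` is an injective
envelope, i.e. has essential image. The terms live in a universe large enough for the ring, so that
`Module.Injective` is injectivity in the category of all modules. -/
structure MinimalInjectiveCoresolution (R : Type u) [Ring R] (M : Type v) [AddCommGroup M]
    [Module R M] where
  E : ℕ → Type (max u v)
  [addCommGroup : ∀ n, AddCommGroup (E n)]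
  [module : ∀ n, Module R (E n)]
  ι : M →ₗ[R] E 0
  d : ∀ n, E n →ₗ[R] E (n + 1)
  injective : ∀ n, Module.Injective R (E n)
  injective_ι : Function.Injective ι
  exact_zero : Function.Exact ι (d 0)
  exact_succ : ∀ n, Function.Exact (d n) (d (n + 1))
  essential_zero : IsEssentialSubmodule (LinearMap.range ι)
  essential_succ : ∀ n, IsEssentialSubmodule (LinearMap.range (d n))

attribute [instance] MinimalInjectiveCoresolution.addCommGroup MinimalInjectiveCoresolution.module


/-- Every module embeds as an essential submodule of an injective module. -/
theorem exists_injective_envelope (R : Type u) [Ring R] (M : ModuleCat.{max u v} R) :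
    ∃ (Q : ModuleCat.{max u v} R) (i : M →ₗ[R] Q), Function.Injective i ∧
      Module.Injective R Q ∧ IsEssentialSubmodule (LinearMap.range i) := by
  obtain ⟨pres⟩ := (ModuleCat.enoughInjectives.{v} R).presentation M
  obtain ⟨Q, hQ, j, hj⟩ := pres
  have hQ' : Module.Injective R Q := Module.injective_module_of_injective_object R Q
  have hj' : Function.Injective j.hom := (ModuleCat.mono_iff_injective j).1 hj
  set A : Submodule R Q := LinearMap.range j.hom with hA
  have key : ∀ P : Submodule R Q → Prop,
      (∀ c : Set (Submodule R Q), c.Nonempty → IsChain (· ≤ ·) c → (∀ B ∈ c, P B) → P (sSup c)) →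
      ∀ B₀, P B₀ → ∃ B, B₀ ≤ B ∧ P B ∧ ∀ B', P B' → B ≤ B' → B' = B := by
    intro P hP B₀ hB₀
    obtain ⟨B, hB, hmax⟩ := zorn_le_nonempty₀ {B | P B} (fun c hc hch y hy =>
      ⟨sSup c, hP c ⟨y, hy⟩ hch hc, fun z hz => le_sSup hz⟩) B₀ hB₀
    exact ⟨B, hB, hmax.prop, fun B' h1 h2 => le_antisymm (hmax.le_of_ge h1 h2) h2⟩
  obtain ⟨B, hAB, hB, hBmax⟩ := key
    (fun B => ∀ N ≤ B, N ⊓ A = ⊥ → N = ⊥) (by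
      intro c hne hch hc N hN hNA
      rw [eq_bot_iff]
      intro t ht
      obtain ⟨B, hBc, htB⟩ := (Submodule.mem_sSup_of_directed hne hch.directedOn).1 (hN ht)
      have h1 : N ⊓ B = ⊥ := hc B hBc (N ⊓ B) inf_le_right (by
        rw [eq_bot_iff, ← hNA]; exact inf_le_inf_right _ inf_le_left)
      rw [← h1]; exact ⟨ht, htB⟩) A (fun N hN h => by rwa [inf_eq_left.2 hN] at h)
  obtain ⟨C, -, hC, hCmax⟩ := key (fun C => C ⊓ B = ⊥) (by
      intro c hne hch hc
      rw [eq_bot_iff]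
      rintro t ⟨ht, htB⟩
      obtain ⟨D, hDc, htD⟩ := (Submodule.mem_sSup_of_directed hne hch.directedOn).1 ht
      rw [← hc D hDc]; exact ⟨htD, htB⟩) ⊥ (by simp)
  have hinj : Function.Injective (C.mkQ ∘ₗ B.subtype) := by
    rw [← LinearMap.ker_eq_bot, eq_bot_iff]
    intro b hb
    have : (b : Q) ∈ C ⊓ B := ⟨by simpa using hb, b.2⟩
    rw [hC] at this
    simpa using this
  obtain ⟨g, hg⟩ := hQ'.out (C.mkQ ∘ₗ B.subtype) hinj B.subtype
  set h : Q →ₗ[R] Q := g ∘ₗ C.mkQ with hh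
  have hB1 : ∀ b ∈ B, h b = b := fun b hb => hg ⟨b, hb⟩
  have hCk : C ≤ LinearMap.ker h := by
    intro t ht
    simp [hh, (Submodule.Quotient.mk_eq_zero C).2 ht]
  have hcom : ∀ N : Submodule R Q, N ⊓ B = ⊥ → N.comap h = C := by
    intro N hN
    refine hCmax _ ?_ (fun t ht => ?_)
    · rw [eq_bot_iff, ← hN]
      rintro t ⟨ht, htB⟩
      exact ⟨by simpa [hB1 t htB] using ht, htB⟩
    · have : h t = 0 := hCk ht
      simp [this]
  have hker : LinearMap.ker h = C := by
    simpa using hcom ⊥ (by simp)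
  have hrange : LinearMap.range h = B := by
    refine hBmax _ (fun N hN hNA => ?_) (fun b hb => ⟨b, hB1 b hb⟩)
    have h1 : N ⊓ B = ⊥ := hB _ inf_le_right (by
      rw [eq_bot_iff, ← hNA]; exact inf_le_inf_right _ inf_le_left)
    have h2 := hcom N h1
    rw [eq_bot_iff]
    intro t ht
    obtain ⟨s, rfl⟩ := hN ht
    have : s ∈ LinearMap.ker h := by rw [hker, ← h2]; exact ht
    simpa using this
  let r : Q →ₗ[R] B := h.codRestrict B (fun t => hrange ▸ ⟨t, rfl⟩)
  refine ⟨ModuleCat.of R B, j.hom.codRestrict B (fun m => hAB ⟨m, rfl⟩), ?_, ⟨?_⟩, ?_⟩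
  · intro a b hab
    exact hj' (congrArg Subtype.val hab)
  · intro X Y _ _ _ _ f hf k
    obtain ⟨l, hl⟩ := hQ'.out f hf (B.subtype ∘ₗ k)
    refine ⟨r ∘ₗ l, fun t => Subtype.ext ?_⟩
    change h (l (f t)) = k t
    rw [hl]
    exact hB1 _ (k t).2
  · intro N hN
    have h1 := hB (N.map B.subtype) (Submodule.map_subtype_le _ _) (by
      rw [eq_bot_iff]
      rintro _ ⟨⟨b, hb, rfl⟩, m, hm⟩
      have : b ∈ N ⊓ LinearMap.range (j.hom.codRestrict B (fun m => hAB ⟨m, rfl⟩)) :=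
        ⟨hb, m, Subtype.ext hm⟩
      rw [hN] at this
      simpa using this)
    exact Submodule.map_injective_of_injective B.injective_subtype (h1.trans (Submodule.map_bot _).symm)

/-- Every module has a minimal injective coresolution. -/
theorem MinimalInjectiveCoresolution.nonempty (R : Type u) [Ring R] (M : Type v) [AddCommGroup M]
    [Module R M] : Nonempty (MinimalInjectiveCoresolution R M) := by
  choose Q i hi hQ he using exists_injective_envelope.{u, v} R
  let M' : ModuleCat.{max u v} R := ModuleCat.of R (ULift.{u} M)
  let step : (Σ X : ModuleCat.{max u v} R, Submodule R X) →
      (Σ X : ModuleCat.{max u v} R, Submodule R X) := fun S =>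
    ⟨Q (ModuleCat.of R (S.1 ⧸ S.2)), LinearMap.range (i (ModuleCat.of R (S.1 ⧸ S.2)))⟩
  let S : ℕ → (Σ X : ModuleCat.{max u v} R, Submodule R X) := fun n =>
    Nat.rec ⟨Q M', LinearMap.range (i M')⟩ (fun _ T => step T) n
  let d : ∀ n, (S n).1 →ₗ[R] (S (n + 1)).1 := fun n =>
    (i (ModuleCat.of R ((S n).1 ⧸ (S n).2))) ∘ₗ (S n).2.mkQ
  let j : M →ₗ[R] (S 0).1 := i M' ∘ₗ (ULift.moduleEquiv (R := R) (M := M)).symm.toLinearMap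
  have hker : ∀ n, LinearMap.ker (d n) = (S n).2 := fun n => by
    rw [LinearMap.ker_comp_of_ker_eq_bot _ (LinearMap.ker_eq_bot.2 (hi _)), Submodule.ker_mkQ]
  have hran : ∀ n, LinearMap.range (d n) = (S (n + 1)).2 := fun n =>
    LinearMap.range_comp_of_range_eq_top _ (Submodule.range_mkQ _)
  have hran0 : LinearMap.range j = (S 0).2 :=
    LinearMap.range_comp_of_range_eq_top _ (LinearEquiv.range _)
  have hess : ∀ n, IsEssentialSubmodule (S n).2 := fun n => by
    cases n with
    | zero => exact he M'
    | succ n => exact he _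
  refine ⟨{ E := fun n => (S n).1, ι := j, d := d, injective := ?_, injective_ι := ?_,
            exact_zero := ?_, exact_succ := ?_, essential_zero := ?_, essential_succ := ?_ }⟩
  · intro n
    cases n with
    | zero => exact hQ M'
    | succ n => exact hQ _
  · exact (hi M').comp (LinearEquiv.injective _)
  · exact LinearMap.exact_iff.2 ((hker 0).trans hran0.symm)
  · exact fun n => LinearMap.exact_iff.2 ((hker (n + 1)).trans (hran n).symm)
  · rw [hran0]; exact hess 0
  · intro n; rw [hran]; exact hess (n + 1)

/-! For finitely generated `C` over a Noetherian ring, cocycles `C → Eⁿ(M)` modulo coboundaries form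
`Extⁿ(C, M)`, and dimension shifting shows that `M ↦ Extⁿ(C, M)` inherits from `Hom(C, M)` the
property that each of its elements comes from one of the `Mᵢ`. In a minimal coresolution the
cocycles are essential in `Eⁿ(M)`, so every map cohomologous to an injective cocycle is injective.
Hence the inclusion of each finitely generated submodule of `Eⁿ(M)` factors through some `Eⁿ(Mᵢ)`,
and such factorizations transfer bounds on the flat dimension: taking free syzygies, which is
functorial, reduces this to the case of flat modules. For (2), maps from finitely presented modules
to a flat module factor through some `Rᵐ`, and the powers `Eⁿ(R)ᵐ` coresolve `Rᵐ`. -/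

section Semimodule

variable {R : Type u} [Semiring R] {M : Type v} [AddCommMonoid M] [Module R M]
  {N : Type w} [AddCommMonoid N] [Module R N] {Q : Type x} [AddCommMonoid Q] [Module R Q]

theorem exists_comp_eq_of_injective {i : M →ₗ[R] N} (hi : Function.Injective i) {f : Q →ₗ[R] N}
    (h : LinearMap.range f ≤ LinearMap.range i) : ∃ t : Q →ₗ[R] M, i ∘ₗ t = f := by
  let e := LinearEquiv.ofInjective i hi
  exact ⟨e.symm.toLinearMap ∘ₗ f.codRestrict _ fun q => h ⟨q, rfl⟩,
    LinearMap.ext fun _ => congrArg Subtype.val (e.apply_symm_apply _)⟩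

theorem exists_comp_eq_of_range_le [Module.Projective R Q] {i : M →ₗ[R] N} {f : Q →ₗ[R] N}
    (h : LinearMap.range f ≤ LinearMap.range i) : ∃ t : Q →ₗ[R] M, i ∘ₗ t = f := by
  obtain ⟨t, ht⟩ := Module.projective_lifting_property i.rangeRestrict
    (f.codRestrict _ fun q => h ⟨q, rfl⟩) i.surjective_rangeRestrict
  exact ⟨t, LinearMap.ext fun q => congrArg Subtype.val (LinearMap.congr_fun ht q)⟩

theorem exact_compLeft {f : M →ₗ[R] N} {g : N →ₗ[R] Q} (h : Function.Exact f g) (ι : Type y) :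
    Function.Exact (f.compLeft ι) (g.compLeft ι) := by
  intro z
  constructor
  · intro hz
    choose t ht using fun i => (h (z i)).1 (congrFun hz i)
    exact ⟨t, funext ht⟩
  · rintro ⟨t, rfl⟩
    exact funext fun i => h.apply_apply_eq_zero (t i)

end Semimodule

section LinearMap

variable {R : Type u} [Ring R] {M : Type v} [AddCommGroup M] [Module R M]
  {N : Type w} [AddCommGroup N] [Module R N] {Q : Type x} [AddCommGroup Q] [Module R Q]

theorem exists_comp_eq_of_surjective {i : M →ₗ[R] N} (hi : Function.Surjective i) {f : M →ₗ[R] Q}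
    (h : LinearMap.ker i ≤ LinearMap.ker f) : ∃ g : N →ₗ[R] Q, g ∘ₗ i = f :=
  ⟨(LinearMap.ker i).liftQ f h ∘ₗ (i.quotKerEquivOfSurjective hi).symm.toLinearMap,
    LinearMap.ext fun m => by simp [LinearMap.quotKerEquivOfSurjective_symm_apply]⟩

theorem exists_comp_eq_of_ker_le (hQ : Module.Baer R Q) {i : M →ₗ[R] N} {f : M →ₗ[R] Q}
    (h : LinearMap.ker i ≤ LinearMap.ker f) : ∃ g : N →ₗ[R] Q, g ∘ₗ i = f := by
  obtain ⟨f', hf'⟩ := exists_comp_eq_of_surjective i.surjective_rangeRestrict (f := f)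
    (by rwa [LinearMap.ker_rangeRestrict])
  obtain ⟨g, hg⟩ := hQ.extension_property _ (LinearMap.range i).injective_subtype f'
  exact ⟨g, by rw [← hf', ← hg]; rfl⟩

end LinearMap

section Character

variable {R : Type u} [Ring R] {X : Type v} [AddCommGroup X] [Module R X]
  {Y : Type w} [AddCommGroup Y] [Module R Y] {Z : Type x} [AddCommGroup Z] [Module R Z]

theorem exists_character_comp_eq {A : Type x} {B : Type y} [AddCommGroup A] [AddCommGroup B]
    (i : A →+ B) (f : A →+ AddCircle (1 : ℚ)) (h : ∀ a, i a = 0 → f a = 0) :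
    ∃ g : B →+ AddCircle (1 : ℚ), ∀ a, g (i a) = f a := by
  obtain ⟨g, hg⟩ := exists_comp_eq_of_ker_le (Module.Baer.of_divisible (AddCircle (1 : ℚ)))
    (i := i.toIntLinearMap) (f := f.toIntLinearMap) h
  exact ⟨g.toAddMonoidHom, LinearMap.congr_fun hg⟩

theorem exists_character_apply_ne_zero_of_notMem {A : Type x} [AddCommGroup A] (S : AddSubgroup A)
    {a : A} (ha : a ∉ S) : ∃ c : A →+ AddCircle (1 : ℚ), (∀ s ∈ S, c s = 0) ∧ c a ≠ 0 := by
  obtain ⟨c, hc⟩ := CharacterModule.exists_character_apply_ne_zero_of_ne_zero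
    (a := (a : A ⧸ S)) (by simpa using ha)
  refine ⟨AddMonoidHom.comp c (QuotientAddGroup.mk' S), fun s hs => ?_, hc⟩
  exact (congrArg c ((QuotientAddGroup.eq_zero_iff s).2 hs)).trans (map_zero c)

/-- The right module structure `(c · r) x = c (r x)` on the character module of a left module. -/
instance characterModuleMulOpposite : Module Rᵐᵒᵖ (CharacterModule X) :=
  inferInstanceAs (Module Rᵈᵐᵃ (X →+ AddCircle (1 : ℚ)))

@[simp] theorem op_smul_character_apply (r : Rᵐᵒᵖ) (c : CharacterModule X) (x : X) :
    (r • c) x = c (r.unop • x) := rfl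

/-- Precomposition with a linear map of left modules, as a map of right character modules. -/
def characterDual (f : X →ₗ[R] Y) : CharacterModule Y →ₗ[Rᵐᵒᵖ] CharacterModule X where
  toFun c := AddMonoidHom.comp c f.toAddMonoidHom
  map_add' _ _ := rfl
  map_smul' r c := DFunLike.ext _ _ fun x => congrArg c (f.map_smul r.unop x).symm

@[simp] theorem characterDual_apply (f : X →ₗ[R] Y) (c : CharacterModule Y) (x : X) :
    characterDual f c x = c (f x) := rfl

theorem characterDual_injective {f : X →ₗ[R] Y} (hf : Function.Surjective f) :
    Function.Injective (characterDual f) :=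
  fun _ _ h => DFunLike.ext _ _ <| hf.forall.2 <| DFunLike.congr_fun h

theorem characterDual_surjective {f : X →ₗ[R] Y} (hf : Function.Injective f) :
    Function.Surjective (characterDual f) := by
  intro c
  obtain ⟨g, hg⟩ := exists_character_comp_eq f.toAddMonoidHom c fun x hx =>
    (congrArg c ((map_eq_zero_iff f hf).1 hx)).trans (map_zero c)
  exact ⟨g, DFunLike.ext _ _ hg⟩

theorem characterDual_exact {f : X →ₗ[R] Y} {g : Y →ₗ[R] Z} (h : Function.Exact f g) :
    Function.Exact (characterDual g) (characterDual f) := by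
  intro c
  constructor
  · intro hc
    obtain ⟨c', hc'⟩ := exists_character_comp_eq g.toAddMonoidHom c fun y hy => by
      obtain ⟨x, rfl⟩ := (h y).1 hy
      exact DFunLike.congr_fun hc x
    exact ⟨c', DFunLike.ext _ _ hc'⟩
  · rintro ⟨c, rfl⟩
    exact DFunLike.ext _ _ fun x => (congrArg c (h.apply_apply_eq_zero x)).trans (map_zero c)

variable {N : Type w} [AddCommGroup N] [Module Rᵐᵒᵖ N]

theorem balancedTensor_op_smul_tmul (r : Rᵐᵒᵖ) (n : N) (x : X) :
    (QuotientAddGroup.mk ((r • n) ⊗ₜ[ℤ] x) : BalancedTensor R N X) =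
      QuotientAddGroup.mk (n ⊗ₜ[ℤ] (r.unop • x)) := by
  rw [← sub_eq_zero, ← QuotientAddGroup.mk_sub, QuotientAddGroup.eq_zero_iff]
  exact AddSubgroup.subset_closure ⟨n, r.unop, x, rfl⟩

/-- The character `n ⊗ x ↦ φ n x` of `N ⊗_R X` given by a homomorphism `φ` from `N` to the
character module of `X`; this is one half of the tensor-hom adjunction. -/
noncomputable def characterUncurry (φ : N →ₗ[Rᵐᵒᵖ] CharacterModule X) :
    BalancedTensor R N X →+ AddCircle (1 : ℚ) :=
  QuotientAddGroup.lift _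
    (TensorProduct.liftAddHom (R := ℤ) (φ.toAddMonoidHom : N →+ (X →+ AddCircle (1 : ℚ)))
      fun r n x => by
        have h : φ (r • n) = r • φ n := map_zsmul φ r n
        exact (DFunLike.congr_fun h x).trans (map_zsmul (φ n) r x).symm) <| by
    refine (AddSubgroup.closure_le _).2 ?_
    rintro _ ⟨n, r, x, rfl⟩
    have h : φ (MulOpposite.op r • n) x = φ n (r • x) := by simp
    exact (map_sub _ _ _).trans (sub_eq_zero.2 h)

/-- The homomorphism `n ↦ (x ↦ g (n ⊗ x))` given by a character `g` of `N ⊗_R X`, inverse to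
`characterUncurry`. -/
noncomputable def characterCurry (g : BalancedTensor R N X →+ AddCircle (1 : ℚ)) :
    N →ₗ[Rᵐᵒᵖ] CharacterModule X where
  toFun n := (g.comp (QuotientAddGroup.mk' _)).comp
    (TensorProduct.mk ℤ N X n).toAddMonoidHom
  map_add' n n' := DFunLike.ext _ _ fun x => by
    change g (QuotientAddGroup.mk ((n + n') ⊗ₜ[ℤ] x)) =
      g (QuotientAddGroup.mk (n ⊗ₜ[ℤ] x)) + g (QuotientAddGroup.mk (n' ⊗ₜ[ℤ] x))
    rw [TensorProduct.add_tmul, QuotientAddGroup.mk_add, map_add]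
  map_smul' r n := DFunLike.ext _ _ fun x => congrArg g (balancedTensor_op_smul_tmul r n x)

theorem balancedTensor_character_ext {g g' : BalancedTensor R N X →+ AddCircle (1 : ℚ)}
    (h : ∀ n x, g (QuotientAddGroup.mk (n ⊗ₜ[ℤ] x)) = g' (QuotientAddGroup.mk (n ⊗ₜ[ℤ] x))) :
    g = g' := by
  refine DFunLike.ext _ _ fun t => ?_
  obtain ⟨t, rfl⟩ := QuotientAddGroup.mk_surjective t
  induction t using TensorProduct.induction_on with
  | zero => simp
  | tmul n x => exact h n x
  | add a b ha hb => rw [QuotientAddGroup.mk_add, map_add, map_add, ha, hb]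

theorem characterUncurry_characterCurry (g : BalancedTensor R N X →+ AddCircle (1 : ℚ)) :
    characterUncurry (characterCurry g) = g :=
  balancedTensor_character_ext fun _ _ => rfl

theorem characterUncurry_comp_map {N' : Type y} [AddCommGroup N'] [Module Rᵐᵒᵖ N']
    (f : N →ₗ[Rᵐᵒᵖ] N') (φ : N' →ₗ[Rᵐᵒᵖ] CharacterModule X) :
    (characterUncurry φ).comp (BalancedTensor.map f X) = characterUncurry (φ ∘ₗ f) :=
  balancedTensor_character_ext fun _ _ => rfl

end Character

section Flat

variable {R : Type u} [Ring R] {X : Type v} [AddCommGroup X] [Module R X]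

theorem isFlatModule_iff_baer : IsFlatModule R X ↔ Module.Baer Rᵐᵒᵖ (CharacterModule X) := by
  constructor
  · intro h J φ
    have hJ : Function.Injective (BalancedTensor.map J.subtype X) := h _ J.injective_subtype
    obtain ⟨g, hg⟩ := exists_character_comp_eq _ (characterUncurry φ) fun t ht => by
      rw [(map_eq_zero_iff _ hJ).1 ht, map_zero]
    exact ⟨characterCurry g, fun r hr => DFunLike.ext _ _ fun x =>
      hg (QuotientAddGroup.mk ((⟨r, hr⟩ : J) ⊗ₜ[ℤ] x))⟩
  · intro h N N' _ _ _ _ f hf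
    refine (injective_iff_map_eq_zero _).2 fun t ht =>
      CharacterModule.eq_zero_of_character_apply fun g => ?_
    obtain ⟨φ, hφ⟩ := h.extension_property f hf (characterCurry g)
    rw [← characterUncurry_characterCurry g, ← hφ, ← characterUncurry_comp_map]
    exact (congrArg (characterUncurry φ) ht).trans (map_zero _)

theorem isFlatModule_iff_exists_character : IsFlatModule R X ↔
    ∀ (J : Ideal Rᵐᵒᵖ) (φ : J →ₗ[Rᵐᵒᵖ] CharacterModule X),
      ∃ c : X →+ AddCircle (1 : ℚ), ∀ (r : J) (x : X), φ r x = c (r.1.unop • x) := by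
  rw [isFlatModule_iff_baer]
  refine forall₂_congr fun J φ => ⟨fun ⟨g, hg⟩ => ⟨g 1, fun r x => ?_⟩, fun ⟨c, hc⟩ =>
    ⟨LinearMap.toSpanSingleton Rᵐᵒᵖ _ c, fun r hr => DFunLike.ext _ _ fun x => ?_⟩⟩
  · have h : φ r = r.1 • g 1 := by rw [← map_smul, smul_eq_mul, mul_one, hg r.1 r.2]
    exact DFunLike.congr_fun h x
  · exact (hc ⟨r, hr⟩ x).symm

theorem isFlatModule_iff_sum_character_eq_zero : IsFlatModule R X ↔
    ∀ (J : Ideal Rᵐᵒᵖ) (φ : J →ₗ[Rᵐᵒᵖ] CharacterModule X) (n : ℕ) (r : Fin n → J) (x : Fin n → X),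
      ∑ i, (r i).1.unop • x i = 0 → ∑ i, φ (r i) (x i) = 0 := by
  rw [isFlatModule_iff_exists_character]
  refine forall₂_congr fun J φ => ⟨fun ⟨c, hc⟩ n r x hrx => ?_, fun h => ?_⟩
  · simp only [hc]
    rw [← map_sum, hrx, map_zero]
  · let mul : J ⊗[ℤ] X →+ X := TensorProduct.liftAddHom (R := ℤ)
      (AddMonoidHom.mk' (fun r : J => DistribSMul.toAddMonoidHom X r.1.unop)
        fun r s => AddMonoidHom.ext fun x => add_smul r.1.unop s.1.unop x)
      fun n r x => (smul_assoc n r.1.unop x).trans (smul_comm n r.1.unop x)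
    obtain ⟨c, hc⟩ := exists_character_comp_eq mul
      ((characterUncurry φ).comp (QuotientAddGroup.mk' _)) fun t ht => by
        obtain ⟨n, r, x, rfl⟩ := t.exists_sum_tmul_eq
        rw [map_sum] at ht ⊢
        exact h n r x ht
    exact ⟨c, fun r x => (hc (r ⊗ₜ x)).symm⟩

theorem IsFlatModule.of_factors (h : ∀ C : Submodule R X, C.FG →
      ∃ (D : Type w) (_ : AddCommGroup D) (_ : Module R D) (a : C →ₗ[R] D) (b : D →ₗ[R] X),
        IsFlatModule R D ∧ b ∘ₗ a = C.subtype) : IsFlatModule R X := by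
  refine isFlatModule_iff_sum_character_eq_zero.2 fun J φ n r x hrx => ?_
  obtain ⟨D, _, _, a, b, hD, hab⟩ := h (Submodule.span R (Set.range x))
    (Submodule.fg_span (Set.finite_range x))
  let x' (i : Fin n) : Submodule.span R (Set.range x) := ⟨x i, Submodule.subset_span ⟨i, rfl⟩⟩
  have hx' : ∑ i, (r i).1.unop • x' i = 0 := Subtype.ext (by simpa [x'] using hrx)
  have hax' : ∑ i, (r i).1.unop • a (x' i) = 0 := by simpa using congrArg a hx'
  have hb (i : Fin n) : b (a (x' i)) = x i := LinearMap.congr_fun hab (x' i)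
  simpa [hb] using isFlatModule_iff_sum_character_eq_zero.1 hD J (characterDual b ∘ₗ φ) n r _ hax'

theorem IsFlatModule.of_equiv {Y : Type w} [AddCommGroup Y] [Module R Y] (e : X ≃ₗ[R] Y)
    (h : IsFlatModule R X) : IsFlatModule R Y :=
  .of_factors fun C _ => ⟨X, _, _, e.symm.toLinearMap ∘ₗ C.subtype, e.toLinearMap, h,
    LinearMap.ext fun c => e.apply_symm_apply c⟩

theorem isFlatModule_of_subsingleton [Subsingleton X] : IsFlatModule R X :=
  isFlatModule_iff_exists_character.2 fun J φ => ⟨0, fun r x => by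
    rw [Subsingleton.elim x 0, map_zero, smul_zero, map_zero]⟩

theorem IsFlatModule.finsupp (h : IsFlatModule R X) (ι : Type w) : IsFlatModule R (ι →₀ X) := by
  refine isFlatModule_iff_exists_character.2 fun J φ => ?_
  choose c hc using fun i : ι =>
    isFlatModule_iff_exists_character.1 h J (characterDual (Finsupp.lsingle i) ∘ₗ φ)
  refine ⟨Finsupp.liftAddHom fun i => (c i), fun r x => ?_⟩
  induction x using Finsupp.induction_linear with
  | zero => simp
  | add x y hx hy => rw [map_add, hx, hy, smul_add, map_add]
  | single i x => simpa using hc i r x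

theorem IsFlatModule.pi (h : IsFlatModule R X) (ι : Type w) [Finite ι] : IsFlatModule R (ι → X) :=
  .of_equiv (Finsupp.linearEquivFunOnFinite R X ι) (h.finsupp ι)

theorem isFlatModule_self : IsFlatModule R R := by
  refine isFlatModule_iff_exists_character.2 fun J φ => ?_
  obtain ⟨c, hc⟩ := exists_character_comp_eq
    (MulOpposite.opAddEquiv.symm.toAddMonoidHom.comp J.subtype.toAddMonoidHom)
    (AddMonoidHom.mk' (fun r => φ r 1) fun r s => DFunLike.congr_fun (map_add φ r s) 1)
    fun r hr => by
      rw [show r = 0 from Subtype.ext (MulOpposite.unop_injective hr), map_zero]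
  refine ⟨c, fun r x => ?_⟩
  calc φ r x = φ (MulOpposite.op x • r) 1 := by simp
    _ = c (r.1.unop • x) := (hc (MulOpposite.op x • r)).symm

end Flat

section Relations

variable {R : Type u} [Ring R] {F : Type v} [AddCommGroup F] [Module R F] {n : ℕ}

variable (F) in
/-- The homomorphism `c ⊗ y ↦ (c₁ y, …, cₙ y)` on the tensor product of the right module of
solutions `c` of `f₁ c₁ + ⋯ + fₙ cₙ = 0` with `F`. Its range consists of the solutions in `F` that
are combinations of solutions in `R`. -/
noncomputable def solutionSmul (f : Fin n → R) :
    LinearMap.ker (Fintype.linearCombination Rᵐᵒᵖ fun j => MulOpposite.op (f j)) ⊗[ℤ] F →+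
      (Fin n → F) :=
  TensorProduct.liftAddHom (R := ℤ)
    (AddMonoidHom.mk'
      (fun c => AddMonoidHom.pi fun j => DistribSMul.toAddMonoidHom F (c.1 j).unop)
      fun c c' => AddMonoidHom.ext fun y => funext fun j =>
        add_smul (c.1 j).unop (c'.1 j).unop y)
    fun m c y => funext fun j => (smul_assoc m (c.1 j).unop y).trans (smul_comm m (c.1 j).unop y)

theorem solutionSmul_tmul (f : Fin n → R)
    (c : LinearMap.ker (Fintype.linearCombination Rᵐᵒᵖ fun j => MulOpposite.op (f j))) (y : F) :
    solutionSmul F f (c ⊗ₜ y) = fun j => (c.1 j).unop • y := rfl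

/-- A character vanishing on the combinations of solutions in `R` induces a homomorphism from the
right ideal `(f₁, …, fₙ)` to the character module of `F`, to which flatness applies. -/
theorem IsFlatModule.mem_range_solutionSmul (hF : IsFlatModule R F) {f : Fin n → R}
    {x : Fin n → F} (h : ∑ j, f j • x j = 0) : x ∈ (solutionSmul F f).range := by
  by_contra hx
  obtain ⟨χ, hχ, hχx⟩ := exists_character_apply_ne_zero_of_notMem _ hx
  let ρ := Fintype.linearCombination Rᵐᵒᵖ fun j => MulOpposite.op (f j)
  let χ' (j : Fin n) : CharacterModule F := χ.comp (AddMonoidHom.single (fun _ => F) j)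
  let θ := Fintype.linearCombination Rᵐᵒᵖ χ'
  have sum_χ (y : Fin n → F) : ∑ j, χ' j (y j) = χ y :=
    (map_sum χ _ _).symm.trans (congrArg χ (Finset.univ_sum_single y))
  have hθ (c : Fin n → Rᵐᵒᵖ) (y : F) : θ c y = χ fun j => (c j).unop • y := by
    refine Eq.trans ?_ (sum_χ _)
    exact (congrArg (fun ψ : CharacterModule F => ψ y)
      (Fintype.linearCombination_apply Rᵐᵒᵖ χ' c)).trans (AddMonoidHom.finsetSum_apply _ _ _)
  have hρθ : LinearMap.ker ρ.rangeRestrict ≤ LinearMap.ker θ := by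
    rw [LinearMap.ker_rangeRestrict]
    exact fun c hc => DFunLike.ext _ _ fun y => (hθ c y).trans (hχ _ ⟨⟨c, hc⟩ ⊗ₜ y, rfl⟩)
  obtain ⟨φ, hφ⟩ := exists_comp_eq_of_surjective ρ.surjective_rangeRestrict hρθ
  have hφ' (j : Fin n) : φ (ρ.rangeRestrict (Pi.single j 1)) = χ' j :=
    (LinearMap.congr_fun hφ _).trans <| by simp [θ]
  refine hχx ?_
  calc χ x = ∑ j, φ (ρ.rangeRestrict (Pi.single j 1)) (x j) := by simp only [hφ', sum_χ]
    _ = 0 := isFlatModule_iff_sum_character_eq_zero.1 hF _ φ n _ x (by simpa [ρ] using h)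

theorem IsFlatModule.exists_eq_sum_smul_of_sum_smul_eq_zero (hF : IsFlatModule R F)
    {f : Fin n → R} {x : Fin n → F} (h : ∑ j, f j • x j = 0) :
    ∃ (m : ℕ) (c : Fin m → Fin n → R) (y : Fin m → F),
      (∀ k, ∑ j, f j * c k j = 0) ∧ x = fun j => ∑ k, c k j • y k := by
  obtain ⟨t, rfl⟩ := hF.mem_range_solutionSmul h
  obtain ⟨m, c, y, rfl⟩ := t.exists_sum_tmul_eq
  refine ⟨m, fun k j => ((c k).1 j).unop, y, fun k => ?_, ?_⟩
  · have hc := LinearMap.mem_ker.1 (c k).2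
    rw [Fintype.linearCombination_apply] at hc
    simpa only [Finset.unop_sum, smul_eq_mul, MulOpposite.unop_mul, MulOpposite.unop_op,
      MulOpposite.unop_zero] using congrArg MulOpposite.unop hc
  · funext j
    simp [solutionSmul_tmul]

end Relations

section Lifting

variable {R : Type u} [Ring R] {M : Type v} [AddCommGroup M] [Module R M]
  {ι : Type w} {M' : ι → Type x} [∀ i, AddCommGroup (M' i)] [∀ i, Module R (M' i)]

/-- Every homomorphism from a finitely presented module to `M` factors through some `f i`. For a
direct limit or for the maps from finite free modules to a flat module this is how `M` is
approximated by the `M' i`. -/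
def LiftsFinitelyPresented (f : ∀ i, M' i →ₗ[R] M) : Prop :=
  ∀ (K : Type u) [AddCommGroup K] [Module R K] [Module.FinitePresentation R K] (φ : K →ₗ[R] M),
    ∃ (i : ι) (φ' : K →ₗ[R] M' i), f i ∘ₗ φ' = φ

theorem exists_lift_apply_eq_zero {f : ∀ i, M' i →ₗ[R] M}
    (hf : ∀ i y, f i y = 0 → ∃ (j : ι) (h : M' i →ₗ[R] M' j), f j ∘ₗ h = f i ∧ h y = 0)
    {K : Type y} [AddCommGroup K] [Module R K] (S : Finset K) (i : ι) (q : K →ₗ[R] M' i)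
    (hS : ∀ s ∈ S, f i (q s) = 0) :
    ∃ (j : ι) (q' : K →ₗ[R] M' j), f j ∘ₗ q' = f i ∘ₗ q ∧ ∀ s ∈ S, q' s = 0 := by
  classical
  induction S using Finset.induction_on with
  | empty => exact ⟨i, q, rfl, by simp⟩
  | insert s S _ ih =>
    obtain ⟨j, q', hq', hS'⟩ := ih fun t ht => hS t (Finset.mem_insert_of_mem ht)
    have hs : f j (q' s) = 0 :=
      (LinearMap.congr_fun hq' s).trans (hS s (Finset.mem_insert_self s S))
    obtain ⟨l, h, hh, hhs⟩ := hf j (q' s) hs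
    refine ⟨l, h ∘ₗ q', by rw [← LinearMap.comp_assoc, hh, hq'], fun t ht => ?_⟩
    obtain rfl | ht := Finset.mem_insert.1 ht
    · exact hhs
    · rw [LinearMap.comp_apply, hS' t ht, map_zero]

theorem liftsFinitelyPresented_of_free {f : ∀ i, M' i →ₗ[R] M}
    (hfree : ∀ (a : ℕ) (q : (Fin a → R) →ₗ[R] M),
      ∃ (i : ι) (q' : (Fin a → R) →ₗ[R] M' i), f i ∘ₗ q' = q)
    (hf : ∀ i y, f i y = 0 → ∃ (j : ι) (h : M' i →ₗ[R] M' j), f j ∘ₗ h = f i ∧ h y = 0) :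
    LiftsFinitelyPresented f := by
  intro K _ _ _ φ
  obtain ⟨a, L, e, S, hSL⟩ := Module.FinitePresentation.exists_fin R K
  let π : (Fin a → R) →ₗ[R] K := e.symm.toLinearMap ∘ₗ L.mkQ
  have hπ : Function.Surjective π := e.symm.surjective.comp (Submodule.mkQ_surjective _)
  have hker : LinearMap.ker π = Submodule.span R S := by simp [π, hSL]
  obtain ⟨i, q, hq⟩ := hfree a (φ ∘ₗ π)
  obtain ⟨j, q', hq', hS⟩ := exists_lift_apply_eq_zero hf S i q fun s hs => by
    have hs' : π s = 0 := LinearMap.mem_ker.1 (hker.ge (Submodule.subset_span hs))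
    exact (LinearMap.congr_fun hq s).trans ((congrArg φ hs').trans (map_zero φ))
  obtain ⟨φ', hφ'⟩ := exists_comp_eq_of_surjective hπ (f := q')
    (hker.trans_le (Submodule.span_le.2 hS))
  exact ⟨j, φ', (LinearMap.cancel_right hπ).1 (by rw [LinearMap.comp_assoc, hφ', hq', hq])⟩

end Lifting

section DirectLimit

variable {R : Type u} [Ring R] {I : Type w} [Preorder I] [IsDirectedOrder I] [Nonempty I]
  [DecidableEq I] {G : I → Type x} [∀ i, AddCommGroup (G i)] [∀ i, Module R (G i)]
  (f : ∀ i j, i ≤ j → G i →ₗ[R] G j) [DirectedSystem G fun i j h => f i j h]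

theorem liftsFinitelyPresented_directLimit_of :
    LiftsFinitelyPresented (Module.DirectLimit.of R I G f) := by
  refine liftsFinitelyPresented_of_free (fun a q => ?_) fun i y hy => ?_
  · choose i y hy using fun j => Module.DirectLimit.exists_of (q (Pi.single j 1))
    obtain ⟨k, hk⟩ := Finite.exists_le i
    refine ⟨k, Fintype.linearCombination R fun j => f (i j) k (hk j) (y j), ?_⟩
    refine LinearMap.pi_ext' fun j => LinearMap.ext_ring ?_
    simp [hy]
  · obtain ⟨j, hij, hj⟩ := Module.DirectLimit.of.zero_exact hy
    exact ⟨j, f i j hij, LinearMap.ext fun z => Module.DirectLimit.of_f, hj⟩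

end DirectLimit

theorem liftsFinitelyPresented_equiv {R : Type u} [Ring R] {M : Type v} [AddCommGroup M]
    [Module R M] {N : Type y} [AddCommGroup N] [Module R N] (e : M ≃ₗ[R] N) :
    LiftsFinitelyPresented fun _ : Unit => e.toLinearMap := by
  intro K _ _ _ φ
  exact ⟨(), e.symm.toLinearMap ∘ₗ φ, LinearMap.ext fun x => e.apply_symm_apply (φ x)⟩

theorem LiftsFinitelyPresented.equiv_comp {R : Type u} [Ring R] {M : Type v} [AddCommGroup M]
    [Module R M] {N : Type y} [AddCommGroup N] [Module R N] {ι : Type w} {M' : ι → Type x}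
    [∀ i, AddCommGroup (M' i)] [∀ i, Module R (M' i)] {f : ∀ i, M' i →ₗ[R] M}
    (hf : LiftsFinitelyPresented f) (e : M ≃ₗ[R] N) :
    LiftsFinitelyPresented fun i => e.toLinearMap ∘ₗ f i := by
  intro K _ _ _ φ
  obtain ⟨i, φ', hφ'⟩ := hf K (e.symm.toLinearMap ∘ₗ φ)
  exact ⟨i, φ', LinearMap.ext fun x => by
    simpa using congrArg e (LinearMap.congr_fun hφ' x)⟩

theorem IsFlatModule.liftsFinitelyPresented {R : Type u} [Ring R] {F : Type v} [AddCommGroup F]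
    [Module R F] (hF : IsFlatModule R F) :
    LiftsFinitelyPresented (R := R) (M := F) (ι := Σ m : ℕ, (Fin m → R) →ₗ[R] F)
      (M' := fun q => Fin q.1 → R) fun q => q.2 := by
  refine liftsFinitelyPresented_of_free (fun a q => ⟨⟨a, q⟩, LinearMap.id, rfl⟩) ?_
  rintro ⟨a, q⟩ f hf
  have hq (z : Fin a → R) : q z = ∑ j, z j • q (Pi.single j 1) := by
    conv_lhs => rw [pi_eq_sum_univ' z]
    simp
  obtain ⟨m, c, y, hc, hy⟩ := hF.exists_eq_sum_smul_of_sum_smul_eq_zero ((hq f).symm.trans hf)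
  refine ⟨⟨m, Fintype.linearCombination R y⟩, Fintype.linearCombination R fun j k => c k j, ?_,
    funext fun k => ?_⟩
  · refine LinearMap.pi_ext' fun j => LinearMap.ext_ring ?_
    simp [Fintype.linearCombination_apply, congrFun hy j]
  · simp [Fintype.linearCombination_apply, hc]

section FlatDimension

variable {R : Type u} [Ring R]

theorem flatDimension_le_iff_exists_resolution {X : Type v} [AddCommGroup X] [Module R X] {k : ℕ} :
    flatDimension R X ≤ k ↔ ∃ P : FlatResolution R X, ∀ i, k < i → Subsingleton (P.F i) := by
  refine ⟨fun h => ?_, fun ⟨P, hP⟩ => sInf_le ⟨k, P, hP, rfl⟩⟩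
  obtain ⟨_, ⟨m, P, hP, rfl⟩, hm⟩ := sInf_lt_iff.1 (h.trans_lt (Nat.cast_lt.2 k.lt_succ_self))
  exact ⟨P, fun i hi => hP i ((Nat.lt_succ_iff.1 (Nat.cast_lt.1 hm)).trans_lt hi)⟩

/-- The resolution `⋯ → 0 → 0 → X → 0` of a zero module. -/
def FlatResolution.ofSubsingleton (X : Type v) [AddCommGroup X] [Module R X] [Subsingleton X] :
    FlatResolution R X where
  F _ := PUnit
  ε := 0
  d _ := 0
  flat _ := isFlatModule_of_subsingleton
  surjective_ε x := ⟨0, Subsingleton.elim _ x⟩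
  exact_zero _ := ⟨fun _ => ⟨0, Subsingleton.elim _ _⟩, fun _ => rfl⟩
  exact_succ _ _ := ⟨fun _ => ⟨0, Subsingleton.elim _ _⟩, fun _ => rfl⟩

/-- The resolution `⋯ → P₁ → P₀ → F → X → 0` obtained by splicing a flat cover `f : F → X` and a
flat resolution `P` of its kernel. -/
def FlatResolution.cons {X : Type v} [AddCommGroup X] [Module R X] {F : Type (max u v)}
    [AddCommGroup F] [Module R F] (hF : IsFlatModule R F) {f : F →ₗ[R] X}
    (hf : Function.Surjective f) (P : FlatResolution.{u, max u v} R (LinearMap.ker f)) :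
    FlatResolution R X where
  F
    | 0 => F
    | i + 1 => P.F i
  addCommGroup
    | 0 => ‹_›
    | i + 1 => P.addCommGroup i
  module
    | 0 => ‹_›
    | i + 1 => P.module i
  ε := f
  d
    | 0 => (LinearMap.ker f).subtype ∘ₗ P.ε
    | i + 1 => P.d i
  flat := by
    rintro (_ | i)
    · exact hF
    · exact P.flat i
  surjective_ε := hf
  exact_zero z := by
    constructor
    · intro hz
      obtain ⟨t, ht⟩ := P.surjective_ε ⟨z, hz⟩
      exact ⟨t, congrArg Subtype.val ht⟩
    · rintro ⟨t, rfl⟩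
      exact (P.ε t).2
  exact_succ
    | 0 => fun z => Submodule.coe_eq_zero.trans (P.exact_zero z)
    | i + 1 => P.exact_succ i

/-- The resolution `⋯ → P₂ → P₁` of the kernel of `P₀ → X`. -/
def FlatResolution.tail {X : Type v} [AddCommGroup X] [Module R X] (P : FlatResolution R X) :
    FlatResolution.{u, max u v} R (LinearMap.ker P.ε) where
  F i := P.F (i + 1)
  ε := (P.d 0).codRestrict _ P.exact_zero.apply_apply_eq_zero
  d i := P.d (i + 1)
  flat i := P.flat (i + 1)
  surjective_ε := fun ⟨z, hz⟩ =>
    let ⟨t, ht⟩ := (P.exact_zero z).1 hz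
    ⟨t, Subtype.ext ht⟩
  exact_zero z := Submodule.coe_eq_zero.symm.trans (P.exact_succ 0 z)
  exact_succ i := P.exact_succ (i + 1)

theorem flatDimension_le_succ_of_ker {X : Type v} [AddCommGroup X] [Module R X]
    {F : Type (max u v)} [AddCommGroup F] [Module R F] (hF : IsFlatModule R F) {f : F →ₗ[R] X}
    (hf : Function.Surjective f) {k : ℕ} (h : flatDimension R (LinearMap.ker f) ≤ k) :
    flatDimension R X ≤ (k + 1 : ℕ) := by
  obtain ⟨P, hP⟩ := flatDimension_le_iff_exists_resolution.1 h
  refine flatDimension_le_iff_exists_resolution.2 ⟨.cons hF hf P, ?_⟩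
  rintro (_ | i) hi
  · exact absurd hi (Nat.not_lt_zero _)
  · exact hP i (Nat.succ_lt_succ_iff.1 hi)

theorem exists_flatDimension_ker_le {X : Type v} [AddCommGroup X] [Module R X] {k : ℕ}
    (h : flatDimension R X ≤ (k + 1 : ℕ)) :
    ∃ (F : Type (max u v)) (_ : AddCommGroup F) (_ : Module R F) (f : F →ₗ[R] X),
      IsFlatModule R F ∧ Function.Surjective f ∧ flatDimension R (LinearMap.ker f) ≤ k := by
  obtain ⟨P, hP⟩ := flatDimension_le_iff_exists_resolution.1 h
  exact ⟨P.F 0, _, _, P.ε, P.flat 0, P.surjective_ε, flatDimension_le_iff_exists_resolution.2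
    ⟨P.tail, fun i hi => hP (i + 1) (Nat.succ_lt_succ hi)⟩⟩

theorem flatDimension_le_zero_iff {X : Type (max u v)} [AddCommGroup X] [Module R X] :
    flatDimension R X ≤ (0 : ℕ) ↔ IsFlatModule R X := by
  rw [flatDimension_le_iff_exists_resolution]
  constructor
  · rintro ⟨P, hP⟩
    have := hP 1 Nat.one_pos
    have hε : Function.Injective P.ε := (injective_iff_map_eq_zero P.ε).2 fun z hz => by
      obtain ⟨t, rfl⟩ := (P.exact_zero z).1 hz
      rw [Subsingleton.elim t 0, map_zero]
    exact (P.flat 0).of_equiv (.ofBijective P.ε ⟨hε, P.surjective_ε⟩)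
  · intro h
    have : Subsingleton (LinearMap.ker (LinearMap.id (R := R) (M := X))) := by
      rw [LinearMap.ker_id]
      infer_instance
    refine ⟨.cons h (f := LinearMap.id) Function.surjective_id (.ofSubsingleton _), ?_⟩
    rintro (_ | i) hi
    · exact absurd hi (lt_irrefl _)
    · exact inferInstanceAs (Subsingleton PUnit)

open CategoryTheory

/-- The character module as an object of the category of right modules. -/
abbrev characterObject (R : Type u) [Ring R] (X : Type (max u v)) [AddCommGroup X] [Module R X] :
    ModuleCat.{max u v} Rᵐᵒᵖ :=
  ModuleCat.of Rᵐᵒᵖ (CharacterModule X)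

theorem isFlatModule_iff_injective {X : Type (max u v)} [AddCommGroup X] [Module R X] :
    IsFlatModule R X ↔ Injective (characterObject.{u, v} R X) := by
  rw [isFlatModule_iff_baer]
  exact ⟨fun h => have := h.injective; Module.injective_object_of_injective_module _ _,
    fun _ => .of_injective (Module.injective_module_of_injective_object _ _)⟩

/-- Dimension shifting along `0 → ker f → F → X → 0`, whose dual is exact with injective middle
term. -/
theorem hasInjectiveDimensionLT_characterObject_ker_iff {X F : Type (max u v)} [AddCommGroup X]
    [Module R X] [AddCommGroup F] [Module R F] (hF : IsFlatModule R F) {f : F →ₗ[R] X}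
    (hf : Function.Surjective f) (n : ℕ) :
    HasInjectiveDimensionLT (characterObject.{u, v} R (LinearMap.ker f)) (n + 1) ↔
      HasInjectiveDimensionLT (characterObject.{u, v} R X) (n + 2) := by
  have hex := characterDual_exact (LinearMap.exact_subtype_ker_map f)
  let S : ShortComplex (ModuleCat.{max u v} Rᵐᵒᵖ) :=
    ShortComplex.mk (X₁ := characterObject.{u, v} R X) (X₂ := characterObject.{u, v} R F)
      (X₃ := characterObject.{u, v} R (LinearMap.ker f)) (ModuleCat.ofHom (characterDual f))
      (ModuleCat.ofHom (characterDual (LinearMap.ker f).subtype))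
      (ModuleCat.hom_ext (LinearMap.ext hex.apply_apply_eq_zero))
  have hS : S.ShortExact :=
    { exact := (ShortComplex.ShortExact.moduleCat_exact_iff_function_exact S).2 hex
      mono_f := (ModuleCat.mono_iff_injective S.f).2 (characterDual_injective hf)
      epi_g := (ModuleCat.epi_iff_surjective S.g).2
        (characterDual_surjective (LinearMap.ker f).injective_subtype) }
  exact hS.hasInjectiveDimensionLT_X₃_iff n (isFlatModule_iff_injective.1 hF)

/-- The kernel of the canonical surjection onto `X` from the free module on the set `X`, i.e. the
first syzygy in a resolution that is functorial in `X`. -/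
noncomputable abbrev freeSyzygy (R : Type u) [Ring R] (X : Type v) [AddCommGroup X] [Module R X] :
    Submodule R (X →₀ R) :=
  LinearMap.ker (Finsupp.linearCombination R (id : X → X))

theorem flatDimension_le_iff_hasInjectiveDimensionLT {X : Type (max u v)} [AddCommGroup X]
    [Module R X] {k : ℕ} :
    flatDimension R X ≤ k ↔ HasInjectiveDimensionLT (characterObject.{u, v} R X) (k + 1) := by
  induction k generalizing X with
  | zero =>
    exact flatDimension_le_zero_iff.{u, v}.trans
      (isFlatModule_iff_injective.trans injective_iff_hasInjectiveDimensionLT_one)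
  | succ k ih =>
    constructor
    · intro h
      obtain ⟨F, _, _, f, hF, hf, hk⟩ := exists_flatDimension_ker_le h
      exact (hasInjectiveDimensionLT_characterObject_ker_iff hF hf k).1 (ih.1 hk)
    · intro h
      have hX := Finsupp.linearCombination_id_surjective R X
      have hF : IsFlatModule R (X →₀ R) := isFlatModule_self.finsupp X
      exact flatDimension_le_succ_of_ker hF hX
        (ih.2 ((hasInjectiveDimensionLT_characterObject_ker_iff.{u, v} hF hX k).2 h))

theorem flatDimension_le_succ_iff {X F : Type (max u v)} [AddCommGroup X]
    [Module R X] [AddCommGroup F] [Module R F] (hF : IsFlatModule R F) {f : F →ₗ[R] X}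
    (hf : Function.Surjective f) {k : ℕ} :
    flatDimension R X ≤ (k + 1 : ℕ) ↔ flatDimension R (LinearMap.ker f) ≤ k := by
  rw [flatDimension_le_iff_hasInjectiveDimensionLT.{u, v},
    flatDimension_le_iff_hasInjectiveDimensionLT.{u, v},
    hasInjectiveDimensionLT_characterObject_ker_iff hF hf]

theorem flatDimension_le_succ_iff_freeSyzygy {X : Type (max u v)} [AddCommGroup X] [Module R X]
    {k : ℕ} : flatDimension R X ≤ (k + 1 : ℕ) ↔ flatDimension R (freeSyzygy R X) ≤ k :=
  flatDimension_le_succ_iff.{u, v} (isFlatModule_self.finsupp X)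
    (Finsupp.linearCombination_id_surjective R X)

section Syzygy

variable {X : Type v} [AddCommGroup X] [Module R X] {Y : Type w} [AddCommGroup Y] [Module R Y]
  {Z : Type x} [AddCommGroup Z] [Module R Z]

/-- The homomorphism of free syzygies induced by a homomorphism of modules. -/
noncomputable def freeSyzygyMap (f : X →ₗ[R] Y) : freeSyzygy R X →ₗ[R] freeSyzygy R Y :=
  (Finsupp.lmapDomain R R f).restrict fun c hc => by
    have h := Finsupp.apply_linearCombination R f id c
    rw [LinearMap.mem_ker.1 hc, map_zero] at h
    rw [LinearMap.mem_ker, Finsupp.lmapDomain_apply, Finsupp.linearCombination_mapDomain]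
    exact h.symm

theorem freeSyzygyMap_comp (g : Y →ₗ[R] Z) (f : X →ₗ[R] Y) :
    freeSyzygyMap (g ∘ₗ f) = freeSyzygyMap g ∘ₗ freeSyzygyMap f :=
  LinearMap.ext fun c => Subtype.ext (Finsupp.mapDomain_comp (f := f) (g := g) (v := c.1))

theorem freeSyzygyMap_injective {f : X →ₗ[R] Y} (hf : Function.Injective f) :
    Function.Injective (freeSyzygyMap f) :=
  fun _ _ h => Subtype.ext (Finsupp.mapDomain_injective hf (congrArg Subtype.val h))

theorem mem_range_freeSyzygyMap_subtype {S : Submodule R X} {c : freeSyzygy R X}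
    (hc : (c.1.support : Set X) ⊆ S) : c ∈ LinearMap.range (freeSyzygyMap S.subtype) := by
  have hcS : c.1 ∈ (Finsupp.supported R R Set.univ).map (Finsupp.lmapDomain R R S.subtype) := by
    rwa [Finsupp.lmapDomain_supported, Finsupp.mem_supported, Set.image_univ,
      Submodule.coe_subtype, Subtype.range_coe]
  obtain ⟨c', -, hc'⟩ := hcS
  refine ⟨⟨c', S.injective_subtype ?_⟩, Subtype.ext hc'⟩
  have h := Finsupp.linearCombination_mapDomain R (v' := (id : X → X)) S.subtype c'
  rw [map_zero, Finsupp.apply_linearCombination]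
  exact h.symm.trans ((congrArg _ hc').trans c.2)

theorem exists_fg_le_range_freeSyzygyMap {C : Submodule R (freeSyzygy R X)} (hC : C.FG) :
    ∃ S : Submodule R X, S.FG ∧ C ≤ LinearMap.range (freeSyzygyMap S.subtype) := by
  classical
  obtain ⟨T, rfl⟩ := hC
  let s : Finset X := T.biUnion fun c => c.1.support
  exact ⟨Submodule.span R s, ⟨s, rfl⟩, Submodule.span_le.2 fun c hc =>
    mem_range_freeSyzygyMap_subtype fun z hz =>
      Submodule.subset_span (Finset.mem_biUnion.2 ⟨c, hc, hz⟩)⟩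

end Syzygy

theorem flatDimension_le_of_factors {X : Type (max u v)} [AddCommGroup X] [Module R X] {k : ℕ}
    (h : ∀ C : Submodule R X, C.FG →
      ∃ (D : Type (max u w)) (_ : AddCommGroup D) (_ : Module R D) (a : C →ₗ[R] D) (b : D →ₗ[R] X),
        flatDimension R D ≤ k ∧ b ∘ₗ a = C.subtype) : flatDimension R X ≤ k := by
  induction k generalizing X with
  | zero =>
    refine flatDimension_le_zero_iff.{u, v}.2 (.of_factors fun C hC => ?_)
    obtain ⟨D, _, _, a, b, hD, hab⟩ := h C hC
    exact ⟨D, _, _, a, b, flatDimension_le_zero_iff.{u, w}.1 hD, hab⟩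
  | succ k ih =>
    refine flatDimension_le_succ_iff_freeSyzygy.{u, v}.2 (ih fun C hC => ?_)
    obtain ⟨S, hS, hCS⟩ := exists_fg_le_range_freeSyzygyMap hC
    obtain ⟨l, hl⟩ := exists_comp_eq_of_injective (i := freeSyzygyMap S.subtype) (f := C.subtype)
      (freeSyzygyMap_injective S.injective_subtype) (C.range_subtype.trans_le hCS)
    obtain ⟨D, _, _, a, b, hD, hab⟩ := h S hS
    refine ⟨freeSyzygy R D, _, _, freeSyzygyMap a ∘ₗ l, freeSyzygyMap b,
      flatDimension_le_succ_iff_freeSyzygy.{u, w}.1 hD, ?_⟩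
    rw [← LinearMap.comp_assoc, ← freeSyzygyMap_comp, hab, hl]

/-- The coordinatewise resolution of `X ^ ι`. -/
def FlatResolution.pi {X : Type v} [AddCommGroup X] [Module R X] (P : FlatResolution R X)
    (ι : Type) [Finite ι] : FlatResolution R (ι → X) where
  F i := ι → P.F i
  ε := P.ε.compLeft ι
  d i := (P.d i).compLeft ι
  flat i := (P.flat i).pi ι
  surjective_ε := P.surjective_ε.comp_left
  exact_zero := exact_compLeft P.exact_zero ι
  exact_succ i := exact_compLeft (P.exact_succ i) ι

theorem flatDimension_pi_le {X : Type v} [AddCommGroup X] [Module R X] (ι : Type) [Finite ι] :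
    flatDimension R (ι → X) ≤ flatDimension R X := by
  obtain hX | hX := eq_or_ne (flatDimension R X) ⊤
  · exact hX ▸ le_top
  · obtain ⟨k, hk⟩ := ENat.ne_top_iff_exists.1 hX
    obtain ⟨P, hP⟩ := flatDimension_le_iff_exists_resolution.1 hk.ge
    exact hk ▸ flatDimension_le_iff_exists_resolution.2 ⟨P.pi ι, fun i hi =>
      have := hP i hi
      inferInstanceAs (Subsingleton (ι → P.F i))⟩

end FlatDimension

section Coresolution

variable {R : Type u} [Ring R]

/-- An injective coresolution `0 → M → E⁰ → E¹ → ⋯`, not necessarily minimal. Injectivity is stated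
as Baer's criterion, which does not depend on the universe of the terms. -/
structure InjectiveCoresolution (R : Type u) [Ring R] (M : Type v) [AddCommGroup M]
    [Module R M] where
  E : ℕ → Type w
  [addCommGroup : ∀ n, AddCommGroup (E n)]
  [module : ∀ n, Module R (E n)]
  ι : M →ₗ[R] E 0
  d : ∀ n, E n →ₗ[R] E (n + 1)
  baer : ∀ n, Module.Baer R (E n)
  injective_ι : Function.Injective ι
  exact_zero : Function.Exact ι (d 0)
  exact_succ : ∀ n, Function.Exact (d n) (d (n + 1))

attribute [instance] InjectiveCoresolution.addCommGroup InjectiveCoresolution.module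

/-- The injective coresolution underlying a minimal one. -/
def MinimalInjectiveCoresolution.toInjectiveCoresolution {M : Type v} [AddCommGroup M] [Module R M]
    (ξ : MinimalInjectiveCoresolution R M) : InjectiveCoresolution R M where
  E := ξ.E
  ι := ξ.ι
  d := ξ.d
  baer n := .of_injective (ξ.injective n)
  injective_ι := ξ.injective_ι
  exact_zero := ξ.exact_zero
  exact_succ := ξ.exact_succ

theorem MinimalInjectiveCoresolution.essential_ker {M : Type v} [AddCommGroup M] [Module R M]
    (ξ : MinimalInjectiveCoresolution R M) (n : ℕ) :
    IsEssentialSubmodule (LinearMap.ker (ξ.d n)) := by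
  cases n with
  | zero => exact ξ.exact_zero.linearMap_ker_eq ▸ ξ.essential_zero
  | succ n => exact (ξ.exact_succ n).linearMap_ker_eq ▸ ξ.essential_succ n

namespace InjectiveCoresolution

variable {M : Type v} [AddCommGroup M] [Module R M]

/-- The coordinatewise coresolution of `M ^ ι`. -/
def pi (A : InjectiveCoresolution.{u, v, w} R M) (ι : Type) :
    InjectiveCoresolution.{u, v, w} R (ι → M) where
  E n := ι → A.E n
  ι := A.ι.compLeft ι
  d n := (A.d n).compLeft ι
  baer n I g := by
    choose t ht using fun i => A.baer n I (LinearMap.proj i ∘ₗ g)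
    exact ⟨LinearMap.pi t, fun z hz => funext fun i => ht i z hz⟩
  injective_ι := A.injective_ι.comp_left
  exact_zero := exact_compLeft A.exact_zero ι
  exact_succ n := exact_compLeft (A.exact_succ n) ι

/-- A morphism of coresolutions over a homomorphism `f` of the coresolved modules. -/
structure Hom {M' : Type x} [AddCommGroup M'] [Module R M']
    (A : InjectiveCoresolution.{u, x, y} R M') (B : InjectiveCoresolution.{u, v, w} R M)
    (f : M' →ₗ[R] M) where
  app : ∀ n, A.E n →ₗ[R] B.E n
  app_comp_ι : app 0 ∘ₗ A.ι = B.ι ∘ₗ f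
  app_comp_d : ∀ n, app (n + 1) ∘ₗ A.d n = B.d n ∘ₗ app n

theorem nonempty_hom {M' : Type x} [AddCommGroup M'] [Module R M']
    (A : InjectiveCoresolution.{u, x, y} R M') (B : InjectiveCoresolution.{u, v, w} R M)
    (f : M' →ₗ[R] M) : Nonempty (Hom A B f) := by
  obtain ⟨α₀, h₀⟩ := exists_comp_eq_of_ker_le (B.baer 0) (i := A.ι) (f := B.ι ∘ₗ f)
    ((LinearMap.ker_eq_bot.2 A.injective_ι).trans_le bot_le)
  -- Each component has to preserve cocycles for the next one to exist.
  let T (n : ℕ) := {a : A.E n →ₗ[R] B.E n //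
    LinearMap.ker (A.d n) ≤ LinearMap.ker (B.d n ∘ₗ a)}
  have hstep (n : ℕ) (a : T n) : ∃ b : T (n + 1), b.1 ∘ₗ A.d n = B.d n ∘ₗ a.1 := by
    obtain ⟨b, hb⟩ := exists_comp_eq_of_ker_le (B.baer (n + 1)) a.2
    refine ⟨⟨b, ?_⟩, hb⟩
    rw [(A.exact_succ n).linearMap_ker_eq, LinearMap.range_le_ker_iff, LinearMap.comp_assoc, hb,
      ← LinearMap.comp_assoc, (B.exact_succ n).linearMap_comp_eq_zero, LinearMap.zero_comp]
  choose step hs using hstep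
  let a₀ : T 0 := ⟨α₀, by
    rw [A.exact_zero.linearMap_ker_eq, LinearMap.range_le_ker_iff, LinearMap.comp_assoc, h₀,
      ← LinearMap.comp_assoc, B.exact_zero.linearMap_comp_eq_zero, LinearMap.zero_comp]⟩
  let a (n : ℕ) : T n := Nat.rec a₀ step n
  exact ⟨fun n => (a n).1, h₀, fun n => hs n (a n)⟩

variable (B : InjectiveCoresolution.{u, v, w} R M)

/-- A homomorphism `C → Eⁿ` is a coboundary if it lifts to `Eⁿ⁻¹`, where `E⁻¹ = 0`. The cocycles
`C → Eⁿ` modulo the coboundaries form `Extⁿ(C, M)`. -/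
def IsCoboundary {C : Type y} [AddCommGroup C] [Module R C] : ∀ n, (C →ₗ[R] B.E n) → Prop
  | 0, h => h = 0
  | n + 1, h => ∃ t : C →ₗ[R] B.E n, B.d n ∘ₗ t = h

variable {B}

theorem IsCoboundary.exists_extension {C : Type x} [AddCommGroup C] [Module R C] {n : ℕ}
    {h : C →ₗ[R] B.E n} (hh : B.IsCoboundary n h) {P : Type y} [AddCommGroup P] [Module R P]
    {j : C →ₗ[R] P} (hj : Function.Injective j) :
    ∃ h' : P →ₗ[R] B.E n, h' ∘ₗ j = h ∧ B.d n ∘ₗ h' = 0 := by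
  cases n with
  | zero =>
    obtain rfl : h = 0 := hh
    exact ⟨0, LinearMap.zero_comp j, LinearMap.comp_zero _⟩
  | succ n =>
    obtain ⟨t, rfl⟩ := hh
    obtain ⟨t', rfl⟩ := (B.baer n).extension_property j hj t
    refine ⟨B.d n ∘ₗ t', rfl, ?_⟩
    rw [← LinearMap.comp_assoc, (B.exact_succ n).linearMap_comp_eq_zero, LinearMap.zero_comp]

theorem injective_of_isCoboundary (hB : ∀ n, IsEssentialSubmodule (LinearMap.ker (B.d n))) {n : ℕ}
    {C : Type x} [AddCommGroup C] [Module R C] {D : Type y} [AddCommGroup D] [Module R D]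
    {g : C →ₗ[R] B.E n} (hg : Function.Injective g) {α : D →ₗ[R] B.E n} {g' : C →ₗ[R] D}
    (h : B.IsCoboundary n (g - α ∘ₗ g')) : Function.Injective g' := by
  cases n with
  | zero =>
    rw [sub_eq_zero.1 h, LinearMap.coe_comp] at hg
    exact hg.of_comp
  | succ n =>
    obtain ⟨t, ht⟩ := h
    have hdt {c : C} (hc : g' c = 0) : B.d n (t c) = g c := by
      simpa [hc] using LinearMap.congr_fun ht c
    have hbot : (LinearMap.ker g').map t = ⊥ := hB n _ <| (Submodule.eq_bot_iff _).2 <| by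
      rintro _ ⟨⟨c, hc, rfl⟩, hd⟩
      rw [(map_eq_zero_iff g hg).1 ((hdt hc).symm.trans hd), map_zero]
    refine (injective_iff_map_eq_zero g').2 fun c hc => (map_eq_zero_iff g hg).1 ?_
    have htc : t c = 0 := (Submodule.mem_bot R).1 (hbot ▸ Submodule.mem_map_of_mem hc)
    rw [← hdt hc, htc, map_zero]

section Approximation

variable {ι : Type*} {M' : ι → Type x} [∀ i, AddCommGroup (M' i)] [∀ i, Module R (M' i)]
  {A : ∀ i, InjectiveCoresolution.{u, x, y} R (M' i)} {f : ∀ i, M' i →ₗ[R] M}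

/-- Every cocycle `C → Eⁿ(M)` on a finitely generated module is cohomologous to the image of a
cocycle `C → Eⁿ(M' i)`: the elements of `Extⁿ(C, M)` come from `Extⁿ(C, M' i)`. -/
def ApproximatesCocycles (α : ∀ i, Hom (A i) B (f i)) (n : ℕ) : Prop :=
  ∀ (C : Type u) [AddCommGroup C] [Module R C] [Module.Finite R C] (g : C →ₗ[R] B.E n),
    B.d n ∘ₗ g = 0 → ∃ (i : ι) (g' : C →ₗ[R] (A i).E n),
      (A i).d n ∘ₗ g' = 0 ∧ B.IsCoboundary n (g - (α i).app n ∘ₗ g')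

variable [IsNoetherianRing R] (α : ∀ i, Hom (A i) B (f i))

theorem approximatesCocycles_zero (hf : LiftsFinitelyPresented f) : ApproximatesCocycles α 0 := by
  intro C _ _ _ g hg
  obtain ⟨φ, rfl⟩ := exists_comp_eq_of_injective B.injective_ι
    ((LinearMap.range_le_ker_iff.2 hg).trans B.exact_zero.linearMap_ker_eq.le)
  have := Module.finitePresentation_of_finite R C
  obtain ⟨i, φ', rfl⟩ := hf C φ
  refine ⟨i, (A i).ι ∘ₗ φ', ?_, sub_eq_zero.2 ?_⟩
  · rw [← LinearMap.comp_assoc, (A i).exact_zero.linearMap_comp_eq_zero, LinearMap.zero_comp]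
  · rw [← LinearMap.comp_assoc, ← LinearMap.comp_assoc, (α i).app_comp_ι]

variable {α}

/-- Dimension shifting along `0 → ker π → Rᵃ → C → 0`. -/
theorem ApproximatesCocycles.succ {n : ℕ} (h : ApproximatesCocycles α n) :
    ApproximatesCocycles α (n + 1) := by
  intro C _ _ _ g hg
  obtain ⟨a, π, hπ⟩ := Module.Finite.exists_fin' R C
  let j := (LinearMap.ker π).subtype
  have hj : Function.Injective j := Submodule.injective_subtype _
  have hπj : π ∘ₗ j = 0 := LinearMap.comp_ker_subtype π
  obtain ⟨p, hp⟩ : ∃ p, B.d n ∘ₗ p = g ∘ₗ π := exists_comp_eq_of_range_le <|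
    (LinearMap.range_comp_le_range π g).trans <|
      (LinearMap.range_le_ker_iff.2 hg).trans (B.exact_succ n).linearMap_ker_eq.le
  obtain ⟨i, g', hg', hcob⟩ := h (LinearMap.ker π) (p ∘ₗ j) <| by
    rw [← LinearMap.comp_assoc, hp, LinearMap.comp_assoc, hπj, LinearMap.comp_zero]
  obtain ⟨p', hp'⟩ := ((A i).baer n).extension_property j hj g'
  obtain ⟨q, hqj, hq⟩ := hcob.exists_extension hj
  obtain ⟨g'', hg''⟩ := exists_comp_eq_of_surjective hπ (f := (A i).d n ∘ₗ p') fun z hz =>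
    (congrArg ((A i).d n) (LinearMap.congr_fun hp' ⟨z, hz⟩)).trans
      (LinearMap.congr_fun hg' ⟨z, hz⟩)
  obtain ⟨s, hs⟩ := exists_comp_eq_of_surjective hπ (f := p - (α i).app n ∘ₗ p' - q) fun z hz => by
    have hp'z : p' z = g' ⟨z, hz⟩ := LinearMap.congr_fun hp' ⟨z, hz⟩
    have hqz : q z = p z - (α i).app n (g' ⟨z, hz⟩) := LinearMap.congr_fun hqj ⟨z, hz⟩
    simp [hp'z, hqz]
  refine ⟨i, g'', (LinearMap.cancel_right hπ).1 ?_, s, (LinearMap.cancel_right hπ).1 ?_⟩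
  · rw [LinearMap.comp_assoc, hg'', ← LinearMap.comp_assoc,
      ((A i).exact_succ n).linearMap_comp_eq_zero, LinearMap.zero_comp, LinearMap.zero_comp]
  · calc (B.d n ∘ₗ s) ∘ₗ π
        = B.d n ∘ₗ p - (B.d n ∘ₗ (α i).app n) ∘ₗ p' - B.d n ∘ₗ q := by
          rw [LinearMap.comp_assoc, hs, LinearMap.comp_sub, LinearMap.comp_sub,
            LinearMap.comp_assoc]
      _ = g ∘ₗ π - (α i).app (n + 1) ∘ₗ g'' ∘ₗ π := by
          rw [hp, hq, sub_zero, ← (α i).app_comp_d, LinearMap.comp_assoc, hg'']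
      _ = (g - (α i).app (n + 1) ∘ₗ g'') ∘ₗ π := by
          rw [LinearMap.sub_comp, LinearMap.comp_assoc]

theorem approximatesCocycles (hf : LiftsFinitelyPresented f) (n : ℕ) :
    ApproximatesCocycles α n := by
  induction n with
  | zero => exact approximatesCocycles_zero α hf
  | succ n ih => exact ih.succ

end Approximation

end InjectiveCoresolution

theorem IsEssentialSubmodule.injective_of_injective_comp_subtype {E : Type v} [AddCommGroup E]
    [Module R E] {A : Submodule R E} (hA : IsEssentialSubmodule A) {C : Submodule R E}
    {D : Type w} [AddCommGroup D] [Module R D] {j : C →ₗ[R] D}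
    (hj : Function.Injective (j ∘ₗ (A.comap C.subtype).subtype)) : Function.Injective j := by
  rw [← LinearMap.ker_eq_bot] at hj ⊢
  refine Submodule.map_injective_of_injective C.injective_subtype ?_
  rw [Submodule.map_bot]
  refine hA _ ((Submodule.eq_bot_iff _).2 ?_)
  rintro _ ⟨⟨c, hc, rfl⟩, hcA⟩
  have hc0 : (⟨c, hcA⟩ : A.comap C.subtype) = 0 := (Submodule.mem_bot R).1 (hj ▸ hc)
  exact congrArg (fun z : A.comap C.subtype => (z : C).1) hc0

theorem IsEssentialSubmodule.exists_comp_eq_subtype {E : Type v} [AddCommGroup E] [Module R E]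
    {A : Submodule R E} (hA : IsEssentialSubmodule A) (hE : Module.Baer R E) {D : Type w}
    [AddCommGroup D] [Module R D] (hD : Module.Baer R D) {C : Submodule R E}
    {g : A.comap C.subtype →ₗ[R] D} (hg : Function.Injective g) :
    ∃ (a : C →ₗ[R] D) (b : D →ₗ[R] E), b ∘ₗ a = C.subtype := by
  obtain ⟨a, rfl⟩ := hD.extension_property _ (Submodule.injective_subtype _) g
  obtain ⟨b, hb⟩ := hE.extension_property a (hA.injective_of_injective_comp_subtype hg) C.subtype
  exact ⟨a, b, hb⟩

theorem MinimalInjectiveCoresolution.exists_factors [IsNoetherianRing R] {M : Type v}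
    [AddCommGroup M] [Module R M] (ξ : MinimalInjectiveCoresolution R M) {ι : Type*}
    {M' : ι → Type x} [∀ i, AddCommGroup (M' i)] [∀ i, Module R (M' i)]
    (A : ∀ i, InjectiveCoresolution.{u, x, y} R (M' i)) {f : ∀ i, M' i →ₗ[R] M}
    (hf : LiftsFinitelyPresented f) (n : ℕ) {C : Submodule R (ξ.E n)} (hC : C.FG) :
    ∃ (i : ι) (a : C →ₗ[R] (A i).E n) (b : (A i).E n →ₗ[R] ξ.E n), b ∘ₗ a = C.subtype := by
  let B := ξ.toInjectiveCoresolution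
  let α (i : ι) : (A i).Hom B (f i) := ((A i).nonempty_hom B (f i)).some
  let Z := (LinearMap.ker (ξ.d n)).comap C.subtype
  have : Module.Finite R C := Module.Finite.iff_fg.2 hC
  obtain ⟨m, S, ⟨e⟩⟩ := Module.Finite.exists_fin_quot_equiv R Z
  let g : (Fin m → R) ⧸ S →ₗ[R] ξ.E n := C.subtype ∘ₗ Z.subtype ∘ₗ e.toLinearMap
  have hg : Function.Injective g :=
    C.injective_subtype.comp (Z.injective_subtype.comp e.injective)
  obtain ⟨i, g', -, hg'⟩ := InjectiveCoresolution.approximatesCocycles (α := α) hf n _ g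
    (LinearMap.ext fun c => (e c).2)
  have hinj : Function.Injective g' := B.injective_of_isCoboundary ξ.essential_ker hg hg'
  exact ⟨i, (ξ.essential_ker n).exists_comp_eq_subtype (B.baer n) ((A i).baer n)
    (g := g' ∘ₗ e.symm.toLinearMap) (hinj.comp e.symm.injective)⟩

theorem MinimalInjectiveCoresolution.flatDimension_le_iSup [IsNoetherianRing R] {M : Type v}
    [AddCommGroup M] [Module R M] (ξ : MinimalInjectiveCoresolution R M) {ι : Type*}
    {M' : ι → Type x} [∀ i, AddCommGroup (M' i)] [∀ i, Module R (M' i)]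
    (A : ∀ i, InjectiveCoresolution.{u, x, max u y} R (M' i)) {f : ∀ i, M' i →ₗ[R] M}
    (hf : LiftsFinitelyPresented f) (n : ℕ) :
    flatDimension R (ξ.E n) ≤ ⨆ i, flatDimension R ((A i).E n) := by
  obtain h | h := eq_or_ne (⨆ i, flatDimension R ((A i).E n)) ⊤
  · exact h ▸ le_top
  obtain ⟨k, hk⟩ := ENat.ne_top_iff_exists.1 h
  refine hk ▸ flatDimension_le_of_factors.{u, v, y} fun C hC => ?_
  obtain ⟨i, a, b, hab⟩ := ξ.exists_factors A hf n hC
  exact ⟨(A i).E n, _, _, a, b, (le_iSup _ i).trans hk.ge, hab⟩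

end Coresolution

theorem theorem4p1 (R : Type u) [Ring R] [IsNoetherianRing R] :
    (∀ (n k : ℕ) (I : Type w) [Preorder I] [IsDirectedOrder I] [Nonempty I] [DecidableEq I]
      (G : I → Type x) [∀ i, AddCommGroup (G i)] [∀ i, Module R (G i)]
      (f : ∀ i j, i ≤ j → G i →ₗ[R] G j) [DirectedSystem G (fun i j h => f i j h)]
      (M : Type y) [AddCommGroup M] [Module R M] (_ : Module.DirectLimit G f ≃ₗ[R] M)
      (ζ : ∀ i, MinimalInjectiveCoresolution R (G i)) (ξ : MinimalInjectiveCoresolution R M),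
      (∀ i, flatDimension R ((ζ i).E n) ≤ k) → flatDimension R (ξ.E n) ≤ k) ∧
    (∀ (n : ℕ) (ξ : MinimalInjectiveCoresolution R R),
      flatDimension R (ξ.E n) =
        sSup {e : ℕ∞ | ∃ (F : Type (max u v)) (_ : AddCommGroup F) (_ : Module R F)
          (ζ : MinimalInjectiveCoresolution R F),
          IsFlatModule R F ∧ e = flatDimension R (ζ.E n)}) := by
  refine ⟨?_, fun n ξ => le_antisymm ?_ (sSup_le ?_)⟩
  · intro n k I _ _ _ _ G _ _ f _ M _ _ e ζ ξ h
    exact (ξ.flatDimension_le_iSup (fun i => (ζ i).toInjectiveCoresolution)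
      ((liftsFinitelyPresented_directLimit_of f).equiv_comp e) n).trans (iSup_le h)
  · obtain ⟨ζ⟩ := MinimalInjectiveCoresolution.nonempty R (ULift.{max u v} R)
    have hflat : IsFlatModule R (ULift.{max u v} R) :=
      isFlatModule_self.of_equiv ULift.moduleEquiv.symm
    refine (ξ.flatDimension_le_iSup (fun _ : Unit => ζ.toInjectiveCoresolution)
      (liftsFinitelyPresented_equiv ULift.moduleEquiv) n).trans (iSup_le fun _ => ?_)
    exact le_sSup ⟨_, _, _, ζ, hflat, rfl⟩
  · rintro _ ⟨F, _, _, ζ, hF, rfl⟩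
    refine (ζ.flatDimension_le_iSup (fun q => ξ.toInjectiveCoresolution.pi (Fin q.1))
      hF.liftsFinitelyPresented n).trans (iSup_le fun q => ?_)
    exact flatDimension_pi_le (Fin q.1)
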